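/- **Theorem 3.** Consider synchronous message passing on a finite connected simple undirected graph $G$ with $n$ nodes. A concrete instance of $G$ is given by an assignment of pairwise distinct IDs from $\{1,\dots,n^4\}$ to the nodes together with a port mapping, that is, for every node $v$ a bijection from its ports $1,\dots,\deg(v)$ to its neighbours (the port numbers at the two ends of an edge are unrelated). All nodes start simultaneously; in every round each node may send one message (a finite bit string of any length) through each of its ports, and then updates its state from the messages it receives and its private randomness; the random choices of different nodes are independent. Initially a node knows only its own ID, its degree and its private randomness; it does not know $n$. An execution elects a leader (implicitly) if from some finite round on no messages are sent and the leader flag of exactly one fixed node is raised. There is an absolute constant $c>0$ such that the following holds. Let $\beta\le 3/56$ and let $\mathcal R$ be a randomized algorithm in this model which, on every concrete instance of every finite connected graph, elects a leader with probability at least $1-\beta$. Then for every 2-connected graph $G_0$ (at least three nodes, connected, and still connected after the removal of any one node) with $n$ nodes and $m$ edges there exist an assignment of distinct IDs from $\{1,\dots,n^4\}$ and a port mapping for which the expected total number of messages sent by $\mathcal R$ on the resulting concrete instance of $G_0$ is at least $c\,m$. -/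

import Mathlib

open MeasureTheory
open scoped ENNReal NNReal

universe u v w

namespace LeaderElection

/-- A finite graph is 2-connected if it has at least three vertices, is connected, and remains
connected after the removal of any single vertex. -/
def TwoConnected {V : Type u} [Fintype V] (G : SimpleGraph V) : Prop :=
  2 < Fintype.card V ∧ G.Connected ∧ ∀ x : V, (G.induce {x}ᶜ).Connected

/-- A concrete graph obtained from the `n`-node graph `G` by fixing an assignment of distinct
node IDs from the range `[1, n ^ 4]` and a port mapping. Since `port x` is a bijection from the
ports of `x` to its neighbours, `deg x` is necessarily the degree of `x` in `G`. The port numbers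
at the two ends of an edge are unrelated. -/
structure Instantiation {V : Type u} [Fintype V] (G : SimpleGraph V) where
  id : V → ℕ
  id_injective : Function.Injective id
  id_mem : ∀ x, id x ∈ Set.Icc 1 (Fintype.card V ^ 4)
  deg : V → ℕ
  port : ∀ x, Fin (deg x) ≃ G.neighborSet x

/-- Messages are finite bit strings (of any length). -/
abbrev Message : Type := List Bool

/-- A randomized synchronous message-passing algorithm, run by every node. A node knows only its
own ID, its degree `d` (its ports are `Fin d`), its private randomness (an element of `Rand`
drawn from the probability measure `coin`), and what it has received so far; in particular it is
not given the number of nodes of the network.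

* `init i d r` is the initial state of a node with ID `i`, degree `d` and private randomness `r`;
* `send d s p` is the message, if any, which a node in state `s` sends through its port `p`;
* `step d q r s` is the state after a round that a node began in state `s` and in which it
  received the messages `q` (`q p` is the message, if any, which arrived through port `p`);
* `leader s` is the value of the leader flag of a node in state `s`.

All of these depend measurably on the randomness and on the state. -/
structure Algorithm (Rand : Type v) (State : Type w)
    [MeasurableSpace Rand] [MeasurableSpace State] where
  coin : Measure Rand
  coin_prob : IsProbabilityMeasure coin
  init : (i d : ℕ) → Rand → State
  send : (d : ℕ) → State → Fin d → Option Message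
  step : (d : ℕ) → (Fin d → Option Message) → Rand → State → State
  leader : State → Bool
  measurable_init : ∀ i d, Measurable (init i d)
  measurable_send : ∀ d (p : Fin d) (o : Option Message), MeasurableSet {s | send d s p = o}
  measurable_step : ∀ d q, Measurable fun x : Rand × State => step d q x.1 x.2
  measurable_leader : MeasurableSet {s | leader s = true}

namespace Instantiation

variable {V : Type u} [Fintype V] {G : SimpleGraph V} (I : Instantiation G)

/-- The neighbour of `x` reached through its port `p`. -/
def nbr (x : V) (p : Fin (I.deg x)) : V := (I.port x p : V)

/-- The port of the neighbour `I.nbr x p` which leads back to `x`. -/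
def backPort (x : V) (p : Fin (I.deg x)) : Fin (I.deg (I.nbr x p)) :=
  (I.port (I.nbr x p)).symm ⟨x, SimpleGraph.Adj.symm (I.port x p).2⟩

end Instantiation

namespace Algorithm

variable {Rand : Type v} {State : Type w} [MeasurableSpace Rand] [MeasurableSpace State]
  (R : Algorithm Rand State) {V : Type u} [Fintype V] {G : SimpleGraph V} (I : Instantiation G)

/-- The states of all nodes at the beginning of round `t`, where all nodes start simultaneously
in round `0` and node `x` has private randomness `ω x`. -/
def state (ω : V → Rand) : ℕ → V → State
  | 0 => fun x => R.init (I.id x) (I.deg x) (ω x)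
  | t + 1 => fun x =>
      R.step (I.deg x)
        (fun p => R.send (I.deg (I.nbr x p)) (state ω t (I.nbr x p)) (I.backPort x p))
        (ω x) (state ω t x)

/-- The message, if any, sent by node `x` through its port `p` in round `t`. -/
def sent (ω : V → Rand) (t : ℕ) (x : V) (p : Fin (I.deg x)) : Option Message :=
  R.send (I.deg x) (R.state I ω t x) p

/-- The total number of messages sent in an execution. -/
noncomputable def messages (ω : V → Rand) : ℝ≥0∞ :=
  ∑' t : ℕ, ∑ x : V, ∑ p : Fin (I.deg x), if (R.sent I ω t x p).isSome then 1 else 0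

/-- The law of the private random choices of the nodes, which are independent. -/
noncomputable def law (V : Type u) [Fintype V] : Measure (V → Rand) :=
  Measure.pi fun _ : V => R.coin

/-- The expected number of messages sent. -/
noncomputable def expectedMessages : ℝ≥0∞ :=
  ∫⁻ ω, R.messages I ω ∂(R.law V)

/-- Implicit leader election is achieved in an execution: from some round on, no messages are
sent, and the flag of exactly one (fixed) node is raised. -/
def Elects (ω : V → Rand) : Prop :=
  ∃ T : ℕ, (∀ t, T ≤ t → ∀ x p, R.sent I ω t x p = none) ∧
    ∃ ℓ : V, ∀ t, T ≤ t → ∀ x, R.leader (R.state I ω t x) = true ↔ x = ℓ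

/-- The probability that a unique leader is elected. -/
noncomputable def successProb : ℝ≥0∞ :=
  R.law V {ω | R.Elects I ω}

end Algorithm

end LeaderElection

/-! If every instance of the graph costs fewer than `m / 4` expected messages, then in each instance
some edge is used with probability below 1/4. Take two instances with disjoint IDs, cut such an edge
in each and join the loose ends across (`dumbbell`). Nodes keep their IDs, degrees and port numbers
and do not know `n`, so while both cut edges would stay silent, each copy behaves exactly as it
would alone (`state_dumbbell`). If moreover both separate runs elect, the joined run has two leaders
(`not_elects_dumbbell`). A union bound then contradicts the success probability on the joined graph,
which is connected because a 2-connected graph has no bridge. -/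

namespace SimpleGraph

variable {V : Type u}

/-- The graph on two copies of `V` obtained from two copies of `G` by redirecting, in copy `i`,
the edge between `a i` and `b i`: the two nodes `a i` are joined, and so are the two nodes `b i`. -/
def dumbbell (G : SimpleGraph V) (a b : Bool → V) : SimpleGraph (V × Bool) where
  Adj x y :=
    (x.2 = y.2 ∧ G.Adj x.1 y.1 ∧ s(x.1, y.1) ≠ s(a x.2, b x.2)) ∨
    (x.2 ≠ y.2 ∧ (x.1 = a x.2 ∧ y.1 = a y.2 ∨ x.1 = b x.2 ∧ y.1 = b y.2))
  symm := ⟨by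
    rintro ⟨x, i⟩ ⟨y, j⟩ (⟨h, h1, h2⟩ | ⟨h, h1⟩)
    · obtain rfl : i = j := h
      exact Or.inl ⟨rfl, h1.symm, by rwa [Sym2.eq_swap]⟩
    · exact Or.inr ⟨Ne.symm h, h1.imp And.symm And.symm⟩⟩
  loopless := ⟨by
    rintro ⟨x, i⟩ (⟨_, h, _⟩ | ⟨h, _⟩)
    · exact G.loopless.irrefl x h
    · exact h rfl⟩

variable {G : SimpleGraph V} {a b : Bool → V}

/-- The node of the dumbbell graph to which the edge of copy `i` from `x` to `y` leads. -/
noncomputable def redirect (a b : Bool → V) (i : Bool) (x y : V) : V × Bool :=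
  open Classical in
  if x = a i ∧ y = b i then (a !i, !i) else if x = b i ∧ y = a i then (b !i, !i) else (y, i)

lemma dumbbell_adj_redirect (i : Bool) {x y : V} (h : G.Adj x y) :
    (G.dumbbell a b).Adj (x, i) (redirect a b i x y) := by
  unfold redirect
  split_ifs with h1 h2
  · exact Or.inr ⟨by simp, Or.inl ⟨h1.1, rfl⟩⟩
  · exact Or.inr ⟨by simp, Or.inr ⟨h2.1, rfl⟩⟩
  · refine Or.inl ⟨rfl, h, ?_⟩
    simp only [ne_eq, Sym2.eq_iff]
    tauto

lemma redirect_of_ne (i : Bool) {x y : V} (h : s(x, y) ≠ s(a i, b i)) :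
    redirect a b i x y = (y, i) := by
  simp only [ne_eq, Sym2.eq_iff, not_or] at h
  simp [redirect, h.1, h.2]

/-- Only `a i` and `b i` see a change, each having one neighbour replaced by a node of the other
copy. Hence the old port numbers remain usable. -/
lemma redirect_bijective (hab : ∀ i, G.Adj (a i) (b i)) (i : Bool) (x : V) :
    Function.Bijective fun y : G.neighborSet x =>
      (⟨redirect a b i x y, dumbbell_adj_redirect i y.2⟩ :
        (G.dumbbell a b).neighborSet (x, i)) := by
  have hne := (hab i).ne
  constructor
  · rintro ⟨y, hy⟩ ⟨z, hz⟩ h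
    have h : redirect a b i x y = redirect a b i x z := congrArg Subtype.val h
    refine Subtype.ext (?_ : y = z)
    have hswap : a (!i) ≠ b (!i) := (hab !i).ne
    unfold redirect at h
    have hi : (!i) ≠ i := by simp
    grind
  · rintro ⟨⟨y, j⟩, ⟨h, h1, h2⟩ | ⟨h, h1⟩⟩
    · obtain rfl : i = j := h
      exact ⟨⟨y, h1⟩, Subtype.ext (redirect_of_ne i h2)⟩
    · obtain rfl : j = !i := by cases i <;> cases j <;> simp_all
      rcases h1 with ⟨h1, h2⟩ | ⟨h1, h2⟩
      · obtain rfl : x = a i := h1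
        obtain rfl : y = a !i := h2
        exact ⟨⟨b i, hab i⟩, Subtype.ext (by simp [redirect])⟩
      · obtain rfl : x = b i := h1
        obtain rfl : y = b !i := h2
        exact ⟨⟨a i, (hab i).symm⟩, Subtype.ext (by simp [redirect, hne, hne.symm])⟩

lemma dumbbell_connected (h : ∀ i, (G.deleteEdges {s(a i, b i)}).Connected) :
    (G.dumbbell a b).Connected := by
  have side (i : Bool) (x : V) : (G.dumbbell a b).Reachable (a i, i) (x, i) := by
    let f : G.deleteEdges {s(a i, b i)} →g G.dumbbell a b :=
      ⟨fun x => (x, i), fun {x y} hxy => by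
        rw [deleteEdges_adj] at hxy
        exact Or.inl ⟨rfl, hxy.1, hxy.2⟩⟩
    exact ((h i).preconnected (a i) x).map f
  have cross (i j : Bool) : (G.dumbbell a b).Reachable (a i, i) (a j, j) := by
    by_cases hij : i = j
    · subst hij; rfl
    · exact Adj.reachable (Or.inr ⟨hij, Or.inl ⟨rfl, rfl⟩⟩)
  have : Nonempty (V × Bool) := ⟨(a true, true)⟩
  exact ⟨fun x y => (side x.2 x.1).symm.trans ((cross x.2 y.2).trans (side y.2 y.1))⟩

end SimpleGraph

namespace LeaderElection

/-! ### Bridgelessness and instances with disjoint IDs -/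

section Graph

variable {V : Type u} [Fintype V] {G : SimpleGraph V}

/-- With a third node `w`, a path from `u` to `w` avoiding `v` and one from `w` to `v` avoiding `u`
together bypass the edge. -/
lemma TwoConnected.connected_deleteEdges (hG : TwoConnected G) {u v : V} (huv : G.Adj u v) :
    (G.deleteEdges {s(u, v)}).Connected := by
  obtain ⟨hcard, hconn, hrem⟩ := hG
  obtain ⟨w, hwu, hwv⟩ : ∃ w, w ≠ u ∧ w ≠ v := by
    classical
    by_contra! hw
    have : (Finset.univ : Finset V) ⊆ {u, v} := fun w _ => by
      by_cases h : w = u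
      · simp [h]
      · simp [hw w h]
    have := (Finset.card_le_card this).trans Finset.card_le_two
    rw [Finset.card_univ] at this
    omega
  have avoid {x y z : V} (hz : z ∈ s(u, v)) (hx : x ≠ z) (hy : y ≠ z) :
      (G.deleteEdges {s(u, v)}).Reachable x y := by
    let f : G.induce {z}ᶜ →g G.deleteEdges {s(u, v)} :=
      ⟨fun x => x, fun {p q} hpq => by
        rw [SimpleGraph.deleteEdges_adj]
        refine ⟨hpq, fun h => ?_⟩
        rw [Set.mem_singleton_iff] at h
        rw [← h, Sym2.mem_iff] at hz
        rcases hz with hz | hz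
        · exact p.2 hz.symm
        · exact q.2 hz.symm⟩
    exact ((hrem z).preconnected ⟨x, hx⟩ ⟨y, hy⟩).map f
  have hr : (G.deleteEdges {s(u, v)}).Reachable u v :=
    (avoid (z := v) (by simp) huv.ne hwv).trans (avoid (z := u) (by simp) hwu huv.ne')
  refine hconn.connected_delete_edge_of_not_isBridge fun hb => ?_
  exact (SimpleGraph.isBridge_iff.1 hb) hr

lemma TwoConnected.exists_instantiations (hG : TwoConnected G) :
    ∃ I : Bool → Instantiation G, ∀ i j x y, (I i).id x = (I j).id y → i = j := by
  classical
  have hn := hG.1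
  set n := Fintype.card V
  -- The two copies use the IDs `1..n` and `n+1..2n`.
  have hn4 : 2 * n ≤ n ^ 4 := by
    calc 2 * n ≤ n ^ 3 * n := Nat.mul_le_mul_right _ (by nlinarith [sq_nonneg n, pow_pos (show 0 < n by omega) 3])
      _ = n ^ 4 := by ring
  let e := Fintype.equivFin V
  refine ⟨fun i =>
    { id := fun x => e x + 1 + i.toNat * n
      id_injective := fun x y h => e.injective (Fin.ext (by simpa using h))
      id_mem := fun x => by
        have hx : (e x : ℕ) < n := (e x).2
        refine ⟨by omega, (?_ : (e x : ℕ) + 1 + i.toNat * n ≤ n ^ 4)⟩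
        cases i <;> simp <;> omega
      deg := fun x => Fintype.card (G.neighborSet x)
      port := fun x => (Fintype.equivFin _).symm }, fun i j x y h => ?_⟩
  have hx : (e x : ℕ) < n := (e x).2
  have hy : (e y : ℕ) < n := (e y).2
  cases i <;> cases j <;> simp at h ⊢ <;> omega

namespace Instantiation

/-- The instance of the dumbbell graph made of two instances with disjoint sets of IDs. -/
noncomputable def dumbbell (I : Bool → Instantiation G)
    (hI : ∀ i j x y, (I i).id x = (I j).id y → i = j) (a b : Bool → V)
    (hab : ∀ i, G.Adj (a i) (b i)) : Instantiation (G.dumbbell a b) where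
  id x := (I x.2).id x.1
  id_injective := by
    rintro ⟨x, i⟩ ⟨y, j⟩ h
    obtain rfl := hI _ _ _ _ h
    exact Prod.ext ((I i).id_injective h) rfl
  id_mem x := by
    have h := (I x.2).id_mem x.1
    refine ⟨h.1, h.2.trans (Nat.pow_le_pow_left ?_ 4)⟩
    rw [Fintype.card_prod, Fintype.card_bool]
    omega
  deg x := (I x.2).deg x.1
  port x := ((I x.2).port x.1).trans
    (Equiv.ofBijective _ (SimpleGraph.redirect_bijective hab x.2 x.1))

/-- The pairs of a node and one of its ports are the directed edges. -/
def dartEquiv (I : Instantiation G) : G.Dart ≃ Σ x : V, Fin (I.deg x) where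
  toFun d := ⟨d.fst, (I.port d.fst).symm ⟨d.snd, d.adj⟩⟩
  invFun s := ⟨(s.1, I.port s.1 s.2), (I.port s.1 s.2).2⟩
  left_inv d := by ext <;> simp
  right_inv s := Sigma.ext rfl (heq_of_eq ((I.port s.1).symm_apply_apply s.2))

end Instantiation

end Graph

namespace Algorithm

variable {Rand : Type v} {State : Type w} [MeasurableSpace Rand] [MeasurableSpace State]
  (R : Algorithm Rand State) {V : Type u} [Fintype V] {G : SimpleGraph V} (I : Instantiation G)

/-- The message, if any, which a node `x` sends to its neighbour `y` in round `t`. -/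
def transmitted (ω : V → Rand) (t : ℕ) {x y : V} (h : G.Adj x y) : Option Message :=
  R.sent I ω t x ((I.port x).symm ⟨y, h⟩)

/-- A message is sent along the edge between `x` and `y`, in either direction. -/
def Crosses (ω : V → Rand) {x y : V} (h : G.Adj x y) : Prop :=
  ∃ t, (R.transmitted I ω t h).isSome ∨ (R.transmitted I ω t h.symm).isSome

lemma state_succ (ω : V → Rand) (t : ℕ) (x : V) :
    R.state I ω (t + 1) x = R.step (I.deg x)
      (fun p => R.transmitted I ω t (I.port x p).2.symm) (ω x) (R.state I ω t x) := rfl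

/-! ### Executions on the joined graph -/

section Dumbbell

variable {R} {I : Bool → Instantiation G} {hI : ∀ i j x y, (I i).id x = (I j).id y → i = j}
  {a b : Bool → V} {hab : ∀ i, G.Adj (a i) (b i)} {ω : V × Bool → Rand}

lemma transmitted_redirect {t : ℕ} {i : Bool} {x y : V} (h : G.Adj x y)
    (hs : R.state (.dumbbell I hI a b hab) ω t (x, i) = R.state (I i) (fun z => ω (z, i)) t x)
    {z : V × Bool} (hz : z = SimpleGraph.redirect a b i x y)
    (h' : (G.dumbbell a b).Adj (x, i) z) :
    R.transmitted (.dumbbell I hI a b hab) ω t h' =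
      R.transmitted (I i) (fun z => ω (z, i)) t h := by
  subst hz
  have : ((Instantiation.dumbbell I hI a b hab).port (x, i)).symm
      ⟨SimpleGraph.redirect a b i x y, h'⟩ = ((I i).port x).symm ⟨y, h⟩ := by
    refine (Equiv.symm_apply_eq _).2 (Subtype.ext ?_)
    change _ = SimpleGraph.redirect a b i x ((I i).port x (((I i).port x).symm ⟨y, h⟩))
    rw [Equiv.apply_symm_apply]
  unfold transmitted sent
  rw [this, hs]
  rfl

/-- By induction on rounds, only the redirected ports could receive something different. There the
message comes from the matching end of the other copy's cut edge, which is silent, just as the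
original neighbour is. -/
lemma state_dumbbell (hc : ∀ i, ¬ R.Crosses (I i) (fun x => ω (x, i)) (hab i)) (t : ℕ)
    (i : Bool) (x : V) :
    R.state (.dumbbell I hI a b hab) ω t (x, i) = R.state (I i) (fun z => ω (z, i)) t x := by
  simp only [Crosses, not_exists, not_or, Option.not_isSome_iff_eq_none] at hc
  induction t generalizing i x with
  | zero => rfl
  | succ t ih =>
    rw [state_succ, state_succ, ih]
    suffices h : (fun p => R.transmitted (.dumbbell I hI a b hab) ω t
        ((Instantiation.dumbbell I hI a b hab).port (x, i) p).2.symm) =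
        fun p => R.transmitted (I i) (fun z => ω (z, i)) t ((I i).port x p).2.symm by
      exact congrArg (fun q => R.step ((I i).deg x) q (ω (x, i)) _) h
    funext p
    have key (y : V) (hy : G.Adj x y) (z : V × Bool)
        (hz : z = SimpleGraph.redirect a b i x y) (hz' : (G.dumbbell a b).Adj z (x, i)) :
        R.transmitted (.dumbbell I hI a b hab) ω t hz' =
          R.transmitted (I i) (fun z => ω (z, i)) t hy.symm := by
      have hne := (hab i).ne
      have hne' := (hab !i).ne
      by_cases h1 : x = a i ∧ y = b i
      · obtain ⟨rfl, rfl⟩ := h1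
        obtain rfl : z = (a !i, !i) := by simpa [SimpleGraph.redirect] using hz
        rw [transmitted_redirect (hab !i) (ih _ _) (by simp [SimpleGraph.redirect]) hz',
          (hc _ t).1, (hc i t).2]
      by_cases h2 : x = b i ∧ y = a i
      · obtain ⟨rfl, rfl⟩ := h2
        obtain rfl : z = (b !i, !i) := by
          simpa [SimpleGraph.redirect, hne, hne.symm] using hz
        rw [transmitted_redirect (hab !i).symm (ih _ _)
          (by simp [SimpleGraph.redirect, hne', hne'.symm]) hz', (hc _ t).2, (hc i t).1]
      have h3 : s(x, y) ≠ s(a i, b i) := by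
        simp only [ne_eq, Sym2.eq_iff]
        tauto
      rw [SimpleGraph.redirect_of_ne i h3] at hz
      subst hz
      exact transmitted_redirect hy.symm (ih _ _)
        (SimpleGraph.redirect_of_ne i (by rwa [Sym2.eq_swap])).symm hz'
    exact key _ ((I i).port x p).2 _ rfl _

lemma not_elects_dumbbell (hc : ∀ i, ¬ R.Crosses (I i) (fun x => ω (x, i)) (hab i))
    (he : ∀ i, R.Elects (I i) fun x => ω (x, i)) :
    ¬ R.Elects (.dumbbell I hI a b hab) ω := by
  rintro ⟨T, -, l, hl⟩
  have (i : Bool) : ∃ y, (y, i) = l := by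
    obtain ⟨T', -, y, hy⟩ := he i
    refine ⟨y, (hl (max T T') (le_max_left _ _) _).1 ?_⟩
    rw [state_dumbbell hc, hy _ (le_max_right _ _)]
  obtain ⟨y, hy⟩ := this true
  obtain ⟨z, hz⟩ := this false
  simpa using congrArg Prod.snd (hy.trans hz.symm)

end Dumbbell

/-! ### Measurability of executions -/

section Measurability

lemma measurable_state (t : ℕ) (x : V) : Measurable fun ω => R.state I ω t x := by
  induction t generalizing x with
  | zero => exact (R.measurable_init _ _).comp (measurable_pi_apply x)
  | succ t ih =>
    -- `step` is measurable only for fixed received messages. This suffices because there are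
    -- countably many possible values of these.
    let _ : MeasurableSpace (Option Message) := ⊤
    have : DiscreteMeasurableSpace (Option Message) := ⟨fun _ => trivial⟩
    have hq : Measurable fun ω : V → Rand =>
        fun p => R.transmitted I ω t (I.port x p).2.symm := by
      refine measurable_pi_lambda _ fun p => measurable_to_countable' fun o => ?_
      exact ih _ (R.measurable_send _ _ o)
    have hstep : Measurable fun z : (Fin (I.deg x) → Option Message) × (Rand × State) =>
        R.step (I.deg x) z.1 z.2.1 z.2.2 :=
      measurable_from_prod_countable_right fun q => R.measurable_step _ q
    exact hstep.comp (hq.prodMk ((measurable_pi_apply x).prodMk (ih x)))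

lemma measurableSet_sent_eq (t : ℕ) (x : V) (p : Fin (I.deg x)) (o : Option Message) :
    MeasurableSet {ω | R.sent I ω t x p = o} :=
  R.measurable_state I t x (R.measurable_send _ p o)

lemma measurableSet_isSome_transmitted (t : ℕ) {x y : V} (h : G.Adj x y) :
    MeasurableSet {ω | (R.transmitted I ω t h).isSome} := by
  have := (R.measurableSet_sent_eq I t x ((I.port x).symm ⟨y, h⟩) none).compl
  convert this using 1
  ext ω
  simp [transmitted, Option.isSome_iff_ne_none]

lemma measurableSet_crosses {x y : V} (h : G.Adj x y) :
    MeasurableSet {ω | R.Crosses I ω h} := by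
  simp only [Crosses, Set.ofPred_exists]
  exact .iUnion fun t => (R.measurableSet_isSome_transmitted I t h).union
    (R.measurableSet_isSome_transmitted I t h.symm)

lemma measurableSet_elects : MeasurableSet {ω | R.Elects I ω} := by
  simp only [Elects, Set.ofPred_exists, Set.ofPred_and, Set.ofPred_forall]
  refine .iUnion fun T => .inter ?_ ?_
  · exact .iInter fun t => .iInter fun _ => .iInter fun x => .iInter fun p =>
      R.measurableSet_sent_eq I t x p none
  · refine .iUnion fun l => .iInter fun t => .iInter fun _ => .iInter fun x => ?_
    have h := R.measurable_state I t x R.measurable_leader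
    by_cases hx : x = l
    · simp only [hx, iff_true]
      exact hx ▸ h
    · simp only [hx, iff_false]
      exact h.compl

end Measurability

/-! ### Marginal laws and message counts -/

instance : IsProbabilityMeasure R.coin := R.coin_prob

instance : IsProbabilityMeasure (R.law V) := by
  unfold law
  infer_instance

/-- It suffices to test boxes: a box pulls back to a box whose factors on the other copy are full
and have mass one. -/
lemma measurePreserving_law (i : Bool) :
    MeasurePreserving (fun (ω : V × Bool → Rand) x => ω (x, i)) (R.law (V × Bool)) (R.law V) := by
  have hm : Measurable fun (ω : V × Bool → Rand) x => ω (x, i) := by fun_prop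
  refine ⟨hm, (Measure.pi_eq fun s hs => ?_).symm⟩
  rw [Measure.map_apply hm (.univ_pi hs)]
  have : (fun (ω : V × Bool → Rand) x => ω (x, i)) ⁻¹' Set.univ.pi s =
      Set.univ.pi fun y : V × Bool => if y.2 = i then s y.1 else Set.univ := by
    ext ω
    simp only [Set.mem_preimage, Set.mem_univ_pi]
    constructor
    · rintro h ⟨x, j⟩
      by_cases hj : j = i
      · subst hj; simpa using h x
      · simp [hj]
    · intro h x
      simpa using h (x, i)
  rw [this, law, Measure.pi_pi, Fintype.prod_prod_type]
  refine Finset.prod_congr rfl fun x _ => ?_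
  cases i <;> simp

lemma sum_isSome_transmitted_eq_messages [Fintype G.Dart] (ω : V → Rand) :
    ∑ d : G.Dart, ∑' t, (if (R.transmitted I ω t d.adj).isSome then 1 else 0 : ℝ≥0∞) =
      R.messages I ω := by
  rw [messages, ← Summable.tsum_finsetSum fun _ _ => ENNReal.summable]
  refine tsum_congr fun t => ?_
  rw [← Fintype.sum_sigma' (fun x p => if (R.sent I ω t x p).isSome then (1 : ℝ≥0∞) else 0)]
  exact Fintype.sum_equiv I.dartEquiv _ _ fun d => rfl

/-- For each directed edge, the indicator of its ever being used is at most the number of messages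
sent along it. -/
lemma sum_law_le_expectedMessages [Fintype G.Dart] :
    ∑ d : G.Dart, R.law V {ω | ∃ t, (R.transmitted I ω t d.adj).isSome} ≤
      R.expectedMessages I := by
  have hm (d : G.Dart) : MeasurableSet {ω | ∃ t, (R.transmitted I ω t d.adj).isSome} := by
    rw [Set.ofPred_exists]
    exact .iUnion fun t => R.measurableSet_isSome_transmitted I t d.adj
  simp_rw [← fun d => lintegral_indicator_one (μ := R.law V) (hm d)]
  rw [← lintegral_finsetSum _ fun d _ => measurable_one.indicator (hm d), expectedMessages]
  refine lintegral_mono fun ω => ?_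
  rw [← R.sum_isSome_transmitted_eq_messages I ω]
  refine Finset.sum_le_sum fun d _ => Set.indicator_apply_le' ?_ fun _ => zero_le
  rintro ⟨t, ht⟩
  refine le_trans ?_ (ENNReal.le_tsum t)
  rw [if_pos ht, Pi.one_apply]

/-- If few messages are expected, then some edge is rarely used. -/
lemma exists_adj_law_crosses_lt {c : ℝ≥0∞} (h : R.expectedMessages I < c * G.edgeSet.ncard) :
    ∃ (x y : V) (hxy : G.Adj x y), R.law V {ω | R.Crosses I ω hxy} < c := by
  classical
  by_contra! hc
  set P : G.Dart → ℝ≥0∞ := fun d => R.law V {ω | ∃ t, (R.transmitted I ω t d.adj).isSome}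
    with hP
  have hle (d : G.Dart) : c ≤ P d + P d.symm := by
    refine (hc d.fst d.snd d.adj).trans (le_trans (measure_mono ?_) (measure_union_le _ _))
    rintro ω ⟨t, ht | ht⟩
    · exact Or.inl ⟨t, ht⟩
    · exact Or.inr ⟨t, ht⟩
  have hsymm : ∑ d : G.Dart, P d.symm = ∑ d, P d :=
    Fintype.sum_equiv (Function.Involutive.toPerm _ SimpleGraph.Dart.symm_involutive) _ _
      fun d => rfl
  -- There are two darts per edge, and pairing each dart with its reverse counts every `P d` twice,
  -- so the factors 2 cancel.
  have hsum : (Fintype.card G.Dart : ℝ≥0∞) * c ≤ 2 * R.expectedMessages I := by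
    calc (Fintype.card G.Dart : ℝ≥0∞) * c = ∑ _d : G.Dart, c := by simp
      _ ≤ ∑ d : G.Dart, (P d + P d.symm) := Finset.sum_le_sum fun d _ => hle d
      _ = 2 * ∑ d, P d := by rw [Finset.sum_add_distrib, hsymm, two_mul]
      _ ≤ _ := by gcongr; exact R.sum_law_le_expectedMessages I
  rw [G.dart_card_eq_twice_card_edges, Nat.cast_mul, Nat.cast_two, mul_assoc, mul_comm _ c]
    at hsum
  rw [← SimpleGraph.coe_edgeFinset, Set.ncard_coe_finset] at h
  exact absurd hsum (not_le.2 ((ENNReal.mul_lt_mul_iff_right (by simp) (by simp)).2 h))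

end Algorithm

end LeaderElection

theorem theorem3 :
    ∃ c : ℝ≥0, 0 < c ∧
      ∀ (Rand : Type v) (State : Type w) [MeasurableSpace Rand] [MeasurableSpace State]
        (R : LeaderElection.Algorithm Rand State) (β : ℝ), β ≤ 3 / 56 →
        (∀ (V : Type u) [Fintype V] (G : SimpleGraph V) (I : LeaderElection.Instantiation G),
          G.Connected → ENNReal.ofReal (1 - β) ≤ R.successProb I) →
        ∀ (V₀ : Type u) [Fintype V₀] (G₀ : SimpleGraph V₀), LeaderElection.TwoConnected G₀ →
          ∃ I₀ : LeaderElection.Instantiation G₀,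
            (c : ℝ≥0∞) * (G₀.edgeSet.ncard : ℝ≥0∞) ≤ R.expectedMessages I₀ := by
  -- Any `c` with `3 * (3 / 56) + 2 * c < 1` would do.
  refine ⟨1 / 4, by norm_num, fun Rand State _ _ R β hβ hR V _ G hG => ?_⟩
  by_contra! hlt
  obtain ⟨I, hI⟩ := hG.exists_instantiations
  choose a b hab hc using fun i => R.exists_adj_law_crosses_lt (I i) (hlt (I i))
  set D := LeaderElection.Instantiation.dumbbell I hI a b hab
  let μ := R.law (V × Bool)
  let E : Bool → Set (V → Rand) := fun i => {ω | R.Elects (I i) ω}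
  let C : Bool → Set (V → Rand) := fun i => {ω | R.Crosses (I i) ω (hab i)}
  let π : Bool → (V × Bool → Rand) → V → Rand := fun i ω x => ω (x, i)
  have success {W : Type u} [Fintype W] {H : SimpleGraph W}
      (J : LeaderElection.Instantiation H) (hH : H.Connected) :
      53 / 56 ≤ (R.law W).real {ω | R.Elects J ω} := by
    have h := (ENNReal.ofReal_le_iff_le_toReal (measure_ne_top _ _)).1 (hR W H J hH)
    rw [measureReal_def]
    linarith
  have hE (i : Bool) : (R.law V).real (E i)ᶜ ≤ 3 / 56 := by
    rw [probReal_compl_eq_one_sub (R.measurableSet_elects (I i))]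
    linarith [success (I i) hG.2.1]
  have hC (i : Bool) : (R.law V).real (C i) ≤ 1 / 4 := by
    have h := ENNReal.toReal_mono (by simp) (hc i).le
    simpa [measureReal_def] using h
  -- The joined run elects only if some copy, run alone, fails or uses its cut edge.
  have hsub : {ω | R.Elects D ω} ⊆ ⋃ i, π i ⁻¹' ((E i)ᶜ ∪ C i) := by
    intro ω hω
    by_contra hn
    simp only [Set.mem_iUnion, Set.mem_preimage, not_exists, Set.mem_union, not_or,
      Set.notMem_compl_iff] at hn
    exact LeaderElection.Algorithm.not_elects_dumbbell (fun i => (hn i).2) (fun i => (hn i).1) hω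
  have hπ (i : Bool) : μ.real (π i ⁻¹' ((E i)ᶜ ∪ C i)) ≤ 3 / 56 + 1 / 4 := by
    rw [(R.measurePreserving_law i).measureReal_preimage
      ((R.measurableSet_elects (I i)).compl.union
        (R.measurableSet_crosses (I i) (hab i))).nullMeasurableSet]
    exact (measureReal_union_le _ _).trans (add_le_add (hE i) (hC i))
  have hD := success D (SimpleGraph.dumbbell_connected fun i => hG.connected_deleteEdges (hab i))
  have hU := (measureReal_mono (μ := μ) hsub).trans (measureReal_iUnion_fintype_le _)
  rw [Fintype.sum_bool] at hU
  -- The union bound gives at most `2 * (3 / 56 + 1 / 4) = 34 / 56`, below the required `53 / 56`.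
  linarith [hπ true, hπ false]
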